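/- Let $\omega^{\uparrow\omega}$ be the set of strictly increasing functions $\omega\to\omega$ (the "reals"; equivalently, infinite subsets of $\omega$ via increasing enumeration) and $\omega^{\uparrow<\omega}$ the set of finite strictly increasing sequences of natural numbers. A tree is a subset $T$ of $\omega^{\uparrow<\omega}$ closed under initial segments; a splitting node of $T$ is a node with at least two immediate successors in $T$; and $[T]$ is the set of $x\in\omega^{\uparrow\omega}$ all of whose finite initial segments belong to $T$. A Sacks tree is a nonempty tree in which every node has an extension that is a splitting node. A Miller tree is a Sacks tree in which every splitting node has infinitely many immediate successors. Let $$s^0=\{X\subseteq\omega^{\uparrow\omega} : \text{for every Sacks tree } T \text{ there is a Sacks tree } S\subseteq T \text{ with } [S]\cap X=\emptyset\}$$ be the Sacks (Marczewski) ideal, and $$m^0=\{X\subseteq\omega^{\uparrow\omega} : \text{for every Miller tree } T \text{ there is a Miller tree } S\subseteq T \text{ with } [S]\cap X=\emptyset\}$$ the Miller ideal. **Theorem.** $s^0\setminus m^0\neq\emptyset$; that is, there is a set of reals that belongs to $s^0$ but not to $m^0$. -/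

import Mathlib

namespace TreeIdeals

/-- The space `ω^{↑ω}` of reals: strictly increasing sequences of natural numbers
(equivalently, infinite subsets of `ω`, each identified with its increasing enumeration). -/
abbrev IncSeq : Type := {x : ℕ → ℕ // StrictMono x}

/-- `σ` is a splitting node of `T`: it has at least two immediate successors in `T`. -/
def IsSplit (T : Descriptive.tree ℕ) (σ : List ℕ) : Prop :=
  ∃ m n : ℕ, m ≠ n ∧ σ ++ [m] ∈ T ∧ σ ++ [n] ∈ T

/-- A Sacks (perfect) tree on `ω^{↑<ω}`: a nonempty tree of finite strictly increasing sequences,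
each node of which has a splitting extension in the tree. -/
structure IsSacks (T : Descriptive.tree ℕ) : Prop where
  increasing : ∀ σ ∈ T, σ.Pairwise (· < ·)
  nonempty : [] ∈ T
  perfect : ∀ σ ∈ T, ∃ τ ∈ T, σ <+: τ ∧ IsSplit T τ

/-- A Miller (superperfect) tree: a Sacks tree on `ω^{↑<ω}`, each splitting node of which
has infinitely many immediate successors. -/
structure IsMiller (T : Descriptive.tree ℕ) : Prop extends IsSacks T where
  superperfect : ∀ σ ∈ T, IsSplit T σ → {n : ℕ | σ ++ [n] ∈ T}.Infinite

/-- `[T]`, the set of infinite branches of `T`: all finite initial segments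
`⟨x 0, …, x (n - 1)⟩` of `x` lie in `T`. -/
def branches (T : Descriptive.tree ℕ) : Set IncSeq :=
  {x | ∀ n : ℕ, (List.range n).map x.1 ∈ T}

/-- The tree ideal attached to a family `P` of trees ordered by inclusion: the sets `X` such that
every `T` in `P` has a subtree `S` in `P` with `[S] ∩ X = ∅`. -/
def treeIdeal (P : Descriptive.tree ℕ → Prop) : Set (Set IncSeq) :=
  {X | ∀ T, P T → ∃ S, P S ∧ S ≤ T ∧ Disjoint (branches S) X}

/-- The Sacks (Marczewski) ideal `s⁰`. -/
def sacksIdeal : Set (Set IncSeq) := treeIdeal IsSacks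

/-- The Miller ideal `m⁰`. -/
def millerIdeal : Set (Set IncSeq) := treeIdeal IsMiller

end TreeIdeals

/-! Take a dominating family of least size, well-ordered so that no proper initial segment can index
a dominating family, and thin it to block sequences giving bounds `u i` that still dominate. Every
compact set lies in some closed set `gapBounded (u i)`. Hence the branches of a Sacks tree T_β
contain an uncountable closed set E_β inside one such set, of index η_β, meeting each earlier one in
a countable set; moreover the colour at η_β is constant or countable-to-one on E_β
(`exists_closed_subset`). A Miller tree can be threaded through sparse blocks: at any index ξ of
large enough rate and for each colour, it has continuum many branches in `gapBounded (u ξ)` that lie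
in no earlier `gapBounded (u j)` (`IsMiller.continuum_le_mk_color`). These meet E_β in a countable
set if η_β ≠ ξ. If η_β = ξ, the same holds once the colour differs from the constant value on E_β,
and fewer than continuum many values have to be avoided. So, enumerating both kinds of trees in type
𝔠, one can choose a branch x_α of the α-th Miller tree outside all E_β with β < α. The set of all
x_α meets every Miller tree, but meets E_β in fewer than 𝔠 points, so a Sacks subtree of T_β avoids
it (`exists_isSacks_disjoint`). -/

open Cardinal Set Topology

namespace TreeIdeals

/-! ### Branches and the topology of `IncSeq` -/

lemma map_range_prefix (x : ℕ → ℕ) {m n : ℕ} (h : m ≤ n) :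
    (List.range m).map x <+: (List.range n).map x := by
  refine List.IsPrefix.map x ?_
  rw [List.prefix_iff_eq_take, List.take_range]
  simp [h]

lemma map_range_eq_iff {x y : ℕ → ℕ} {n : ℕ} :
    (List.range n).map x = (List.range n).map y ↔ ∀ i < n, x i = y i := by
  simp

lemma pairwise_map_range (x : IncSeq) (n : ℕ) : ((List.range n).map x.1).Pairwise (· < ·) := by
  rw [List.pairwise_map]
  exact List.pairwise_lt_range.imp fun h => x.2 h

/-- A chain of nodes of unbounded length in a tree of increasing sequences determines a branch. -/
lemma exists_branch_of_chain {T : Descriptive.tree ℕ} (hinc : ∀ σ ∈ T, σ.Pairwise (· < ·))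
    (σ : ℕ → List ℕ) (hT : ∀ k, σ k ∈ T) (hpre : ∀ k, σ k <+: σ (k + 1))
    (hlen : ∀ n, ∃ k, n ≤ (σ k).length) :
    ∃ x ∈ branches T, ∀ k, σ k = (List.range (σ k).length).map x.1 := by
  have hmono : ∀ j k, j ≤ k → σ j <+: σ k := by
    intro j k hjk
    induction hjk with
    | refl => exact List.prefix_rfl
    | step _ ih => exact ih.trans (hpre _)
  choose K hK using fun n => hlen (n + 1)
  let x : ℕ → ℕ := fun n => (σ (K n))[n]'(hK n)
  have hx : ∀ k n (h : n < (σ k).length), (σ k)[n] = x n := by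
    intro k n h
    rcases le_total k (K n) with hle | hle
    · exact (hmono _ _ hle).getElem h
    · exact ((hmono _ _ hle).getElem (hK n)).symm
  have hseg : ∀ k, σ k = (List.range (σ k).length).map x := by
    intro k
    refine List.ext_getElem (by simp) fun n h₁ h₂ => ?_
    simp [hx k n h₁]
  have hxmono : StrictMono x := by
    refine strictMono_nat_of_lt_succ fun n => ?_
    have h1 := hK (n + 1)
    have := List.pairwise_iff_getElem.1 (hinc _ (hT (K (n + 1)))) n (n + 1) (by omega) (by omega)
      (by omega)
    rwa [hx, hx] at this
  refine ⟨⟨x, hxmono⟩, fun n => ?_, hseg⟩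
  have h := hT (K n)
  rw [hseg] at h
  exact Descriptive.Tree.mem_of_prefix (map_range_prefix x (by have := hK n; omega)) h

lemma nhds_hasBasis (x : IncSeq) :
    (𝓝 x).HasBasis (fun _ : ℕ => True) fun n => {y : IncSeq | ∀ i < n, y.1 i = x.1 i} := by
  refine ⟨fun U => ⟨fun hU => ?_, ?_⟩⟩
  · obtain ⟨V, hV, hVU⟩ := Filter.mem_comap.1
      ((Topology.IsInducing.subtypeVal.nhds_eq_comap x).ge hU)
    rw [nhds_pi, Filter.mem_pi] at hV
    obtain ⟨I, hI, t, ht, htV⟩ := hV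
    obtain ⟨N, hN⟩ := hI.bddAbove
    refine ⟨N + 1, trivial, fun y hy => hVU (htV fun i hi => ?_)⟩
    rw [hy i (Nat.lt_succ_of_le (hN hi))]
    exact mem_of_mem_nhds (ht i)
  · rintro ⟨n, -, hn⟩
    refine Filter.mem_of_superset (IsOpen.mem_nhds (s := {y : IncSeq | ∀ i < n, y.1 i = x.1 i})
      ?_ fun i _ => rfl) hn
    have : {y : IncSeq | ∀ i < n, y.1 i = x.1 i} =
        ⋂ i ∈ Finset.range n, (fun y : IncSeq => y.1 i) ⁻¹' {x.1 i} := by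
      ext y; simp
    rw [this]
    exact isOpen_biInter_finset fun i _ =>
      (isOpen_discrete _).preimage ((continuous_apply i).comp continuous_subtype_val)

instance : PolishSpace IncSeq := by
  refine IsClosed.polishSpace (s := {x : ℕ → ℕ | StrictMono x}) ?_
  have : {x : ℕ → ℕ | StrictMono x} = ⋂ n, {x | x n < x (n + 1)} := by
    ext x
    simp only [mem_ofPred_eq, mem_iInter]
    exact ⟨fun h n => h n.lt_succ_self, strictMono_nat_of_lt_succ⟩
  rw [this]
  refine isClosed_iInter fun n => ?_
  exact (isClosed_discrete {p : ℕ × ℕ | p.1 < p.2}).preimage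
    (f := fun x : ℕ → ℕ => (x n, x (n + 1))) (by fun_prop)

lemma isClosed_branches (T : Descriptive.tree ℕ) : IsClosed (branches T) := by
  refine isClosed_iff_clusterPt.2 fun x hx n => ?_
  obtain ⟨y, hy, hyT⟩ := clusterPt_principal_iff.1 hx _ ((nhds_hasBasis x).mem_of_mem (i := n) trivial)
  rw [← map_range_eq_iff.2 hy]
  exact hyT n

/-! ### Sacks trees and perfect sets -/

lemma IsSacks.exists_branch {T : Descriptive.tree ℕ} (hT : IsSacks T) {σ : List ℕ} (hσ : σ ∈ T) :
    ∃ x ∈ branches T, σ = (List.range σ.length).map x.1 := by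
  have hstep : ∀ ρ : {ρ // ρ ∈ T}, ∃ τ : {ρ // ρ ∈ T}, ρ.1 <+: τ.1 ∧ ρ.1.length < τ.1.length := by
    rintro ⟨ρ, hρ⟩
    obtain ⟨τ, -, hτ, m, -, -, hm, -⟩ := hT.perfect ρ hρ
    refine ⟨⟨τ ++ [m], hm⟩, hτ.trans (List.prefix_append _ _), ?_⟩
    have := hτ.length_le
    simp only [List.length_append, List.length_singleton]
    omega
  choose f hf hflen using hstep
  have hlen : ∀ n, n ≤ ((f^[n] ⟨σ, hσ⟩ : {ρ // ρ ∈ T}) : List ℕ).length := by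
    intro n
    induction n with
    | zero => exact Nat.zero_le _
    | succ n ih =>
      rw [Function.iterate_succ_apply']
      exact ih.trans_lt (hflen _)
  obtain ⟨x, hx, h⟩ := exists_branch_of_chain hT.increasing (fun n => (f^[n] ⟨σ, hσ⟩).1)
    (fun n => (f^[n] ⟨σ, hσ⟩).2)
    (fun n => by simp only [Function.iterate_succ_apply']; exact hf _) fun n => ⟨n, hlen n⟩
  exact ⟨x, hx, h 0⟩

lemma IsSacks.perfect_branches {T : Descriptive.tree ℕ} (hT : IsSacks T) :
    Perfect (branches T) := by
  refine ⟨isClosed_branches T, fun x hx => accPt_iff_nhds.2 fun U hU => ?_⟩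
  obtain ⟨n, -, hn⟩ := (nhds_hasBasis x).mem_iff.1 hU
  obtain ⟨τ, -, hτ, m, m', hne, hm, hm'⟩ := hT.perfect _ (hx n)
  have key : ∃ k, τ ++ [k] ∈ T ∧ x.1 τ.length ≠ k := by
    by_cases h : x.1 τ.length = m
    · exact ⟨m', hm', h ▸ hne⟩
    · exact ⟨m, hm, h⟩
  obtain ⟨k, hk, hxk⟩ := key
  obtain ⟨y, hy, hyk⟩ := hT.exists_branch hk
  refine ⟨y, ⟨hn fun i hi => ?_, hy⟩, ?_⟩
  · have h1 := (hτ.trans (List.prefix_append τ [k]))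
    have h2 := h1.getElem (i := i) (by simpa using hi)
    rw [List.getElem_of_eq hyk] at h2
    simpa using h2.symm
  · rintro rfl
    have h2 := List.getElem_of_eq hyk (i := τ.length) (by simp)
    simp at h2
    exact hxk h2.symm

lemma not_countable_range_of_injective {α : Type} {f : (ℕ → Bool) → α}
    (hf : Function.Injective f) : ¬ (range f).Countable := by
  rw [← le_aleph0_iff_set_countable, mk_range_eq f hf, not_le]
  simpa using cantor ℵ₀

lemma IsSacks.not_countable_branches {T : Descriptive.tree ℕ} (hT : IsSacks T) :
    ¬ (branches T).Countable := by
  let := TopologicalSpace.upgradeIsCompletelyMetrizable IncSeq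
  obtain ⟨x, hx, -⟩ := hT.exists_branch hT.nonempty
  obtain ⟨f, hf, -, hinj⟩ := hT.perfect_branches.exists_nat_bool_injection ⟨x, hx⟩
  exact fun h => not_countable_range_of_injective hinj (h.mono hf)

/-- The tree of initial segments of the elements of `C`. -/
def treeOf (C : Set IncSeq) : Descriptive.tree ℕ :=
  ⟨{σ | ∃ x ∈ C, σ = (List.range σ.length).map x.1}, by
    rintro σ a ⟨x, hx, h⟩
    refine ⟨x, hx, ?_⟩
    rw [List.length_append, List.length_singleton, List.range_succ, List.map_append] at h
    exact (List.append_inj h (by simp)).1⟩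

lemma mem_treeOf {C : Set IncSeq} {σ : List ℕ} :
    σ ∈ treeOf C ↔ ∃ x ∈ C, σ = (List.range σ.length).map x.1 := Iff.rfl

lemma map_range_mem_treeOf {C : Set IncSeq} {x : IncSeq} (hx : x ∈ C) (n : ℕ) :
    (List.range n).map x.1 ∈ treeOf C := mem_treeOf.2 ⟨x, hx, by simp⟩

lemma branches_treeOf {C : Set IncSeq} (hC : IsClosed C) : branches (treeOf C) = C := by
  refine Subset.antisymm (fun x hx => ?_) fun x hx n => map_range_mem_treeOf hx n
  refine isClosed_iff_clusterPt.1 hC x (clusterPt_principal_iff.2 fun U hU => ?_)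
  obtain ⟨n, -, hn⟩ := (nhds_hasBasis x).mem_iff.1 hU
  obtain ⟨y, hy, h⟩ := mem_treeOf.1 (hx n)
  refine ⟨y, hn fun i hi => ?_, hy⟩
  simp only [List.length_map, List.length_range] at h
  exact (map_range_eq_iff.1 h i hi).symm

lemma treeOf_le {C : Set IncSeq} {T : Descriptive.tree ℕ} (h : C ⊆ branches T) :
    treeOf C ≤ T := by
  intro σ hσ
  obtain ⟨x, hx, hσx⟩ := mem_treeOf.1 hσ
  rw [hσx]
  exact h hx _

lemma isSacks_treeOf {C : Set IncSeq} (hne : C.Nonempty) (hC : Preperfect C) :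
    IsSacks (treeOf C) := by
  refine ⟨fun σ hσ => ?_, ?_, fun σ hσ => ?_⟩
  · obtain ⟨x, -, h⟩ := mem_treeOf.1 hσ
    rw [h]
    exact pairwise_map_range x _
  · obtain ⟨x, hx⟩ := hne
    exact mem_treeOf.2 ⟨x, hx, rfl⟩
  · obtain ⟨x, hx, h⟩ := mem_treeOf.1 hσ
    obtain ⟨y, ⟨hy, hyC⟩, hyx⟩ := accPt_iff_nhds.1 (hC x hx) _
      ((nhds_hasBasis x).mem_of_mem (i := σ.length) trivial)
    have hex : ∃ i, y.1 i ≠ x.1 i := by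
      by_contra! hall
      exact hyx (Subtype.ext (funext hall))
    classical
    let N := Nat.find hex
    have hN : y.1 N ≠ x.1 N := Nat.find_spec hex
    have hlt : ∀ i < N, y.1 i = x.1 i := fun i hi => not_not.1 (Nat.find_min hex hi)
    have hle : σ.length ≤ N := by
      by_contra! hlt'
      exact hN (hy N hlt')
    refine ⟨(List.range N).map x.1, map_range_mem_treeOf hx _, ?_, x.1 N, y.1 N, hN.symm, ?_, ?_⟩
    · rw [h]
      exact map_range_prefix _ hle
    · simpa [List.range_succ] using map_range_mem_treeOf hx (N + 1)
    · rw [← map_range_eq_iff.2 hlt]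
      simpa [List.range_succ] using map_range_mem_treeOf hyC (N + 1)

lemma preperfect_range {f : (ℕ → Bool) → IncSeq} (hf : Continuous f)
    (hinj : Function.Injective f) : Preperfect (range f) := by
  rintro _ ⟨c, rfl⟩
  refine accPt_iff_nhds.2 fun U hU => ?_
  have h := hf.continuousAt.preimage_mem_nhds hU
  rw [nhds_pi, Filter.mem_pi] at h
  obtain ⟨I, hI, t, ht, htU⟩ := h
  obtain ⟨N, hN⟩ := hI.infinite_compl.nonempty
  refine ⟨f (Function.update c N (!c N)), ⟨htU fun i hi => ?_, mem_range_self _⟩, ?_⟩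
  · rw [Function.update_of_ne (by rintro rfl; exact hN hi)]
    exact mem_of_mem_nhds (ht i)
  · intro h
    have := congrFun (hinj h) N
    simp at this

/-- An uncountable closed set of branches of `T` contains, off any set of size less than the
continuum, the branches of a Sacks subtree of `T`. -/
lemma exists_isSacks_disjoint {T : Descriptive.tree ℕ} {C Y : Set IncSeq} (hC : IsClosed C)
    (hunc : ¬ C.Countable) (hCT : C ⊆ branches T) (hY : #↥(C ∩ Y) < 𝔠) :
    ∃ S, IsSacks S ∧ S ≤ T ∧ Disjoint (branches S) Y := by
  obtain ⟨f, hfC, hf, hinj⟩ := hC.exists_nat_bool_injection_of_not_countable hunc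
  -- Interleaving splits the Cantor set into continuum many disjoint perfect fibres, one for each
  -- `u`. If all of them met `Y`, then `C ∩ Y` would have at least continuum many points.
  let g : (ℕ → Bool) × (ℕ → Bool) → (ℕ → Bool) :=
    fun p n => if n % 2 = 0 then p.1 (n / 2) else p.2 (n / 2)
  have hg : Continuous g := by
    refine continuous_pi fun n => ?_
    by_cases h : n % 2 = 0
    · simp only [g, h, if_true]; fun_prop
    · simp only [g, h, if_false]; fun_prop
  have hg1 : ∀ p n, g p (2 * n) = p.1 n := fun p n => by simp [g]
  have hg2 : ∀ p n, g p (2 * n + 1) = p.2 n := fun p n => by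
    have h1 : (2 * n + 1) % 2 = 1 := by omega
    have h2 : (2 * n + 1) / 2 = n := by omega
    simp [g, h1, h2]
  have hex : ∃ u : ℕ → Bool, ∀ v, f (g (u, v)) ∉ Y := by
    by_contra! hcon
    choose v hv using hcon
    have hinj' : Function.Injective
        fun u => (⟨f (g (u, v u)), hfC (mem_range_self _), hv u⟩ : ↥(C ∩ Y)) := by
      intro u u' h
      have h1 := hinj (Subtype.ext_iff.1 h)
      funext n
      exact (hg1 (u, v u) n).symm.trans ((congrFun h1 _).trans (hg1 _ n))
    have := mk_le_of_injective hinj'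
    rw [show #(ℕ → Bool) = 𝔠 by simp] at this
    exact this.not_gt hY
  obtain ⟨u, hu⟩ := hex
  have hφ : Continuous fun v => f (g (u, v)) := by fun_prop
  have hφinj : Function.Injective fun v => f (g (u, v)) := by
    intro v v' h
    have h1 := hinj h
    funext n
    exact (hg2 (u, v) n).symm.trans ((congrFun h1 _).trans (hg2 _ n))
  have hcl : IsClosed (range fun v => f (g (u, v))) := (isCompact_range hφ).isClosed
  have hsub : (range fun v => f (g (u, v))) ⊆ C := by
    rintro _ ⟨v, rfl⟩
    exact hfC (mem_range_self _)
  refine ⟨treeOf _, isSacks_treeOf (range_nonempty _) (preperfect_range hφ hφinj),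
    treeOf_le (hsub.trans hCT), ?_⟩
  rw [branches_treeOf hcl, disjoint_left]
  rintro _ ⟨v, rfl⟩
  exact hu v


/-! ### Block sequences along a dominating family -/

/-- `[b k, a (k + 1))` is a block long enough for the rate `g`; the gap `[a k, b k)` precedes it. -/
structure IsBlockSeq (g a b : ℕ → ℕ) : Prop where
  le : ∀ k, a k ≤ b k
  lt : ∀ k, b k < a (k + 1)
  rate_le : ∀ k, g (b k) ≤ a (k + 1)
  rate_zero_le : g 0 ≤ a 0

lemma IsBlockSeq.strictMono {g a b : ℕ → ℕ} (h : IsBlockSeq g a b) : StrictMono a :=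
  strictMono_nat_of_lt_succ fun k => (h.le k).trans_lt (h.lt k)

lemma IsBlockSeq.monotone {g a b : ℕ → ℕ} (h : IsBlockSeq g a b) : Monotone b :=
  monotone_nat_of_le_succ fun k => (h.lt k).le.trans (h.le _)

lemma exists_strictMono_ge (g : ℕ → ℕ) : ∃ f : ℕ → ℕ, StrictMono f ∧ (∀ n, g n ≤ f n) ∧
    ∀ n, n < f n := by
  refine ⟨fun n => n + 1 + ∑ i ∈ Finset.range (n + 1), g i,
    strictMono_nat_of_lt_succ fun n => ?_, fun n => ?_, fun n => ?_⟩
  · simp only [Finset.sum_range_succ _ (n + 1)]; omega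
  · simp only [Finset.sum_range_succ]; omega
  · dsimp only; omega

/-- If no family indexed by `I` is dominating, block sequences can be chosen with gaps that are
long from the point of view of each member of a given family. -/
lemma exists_isBlockSeq {I : Type} (hI : ∀ E : I → ℕ → ℕ, ∃ h : ℕ → ℕ, ∀ i, ¬ h ≤ E i)
    (g : ℕ → ℕ) (v : I → ℕ → ℕ) :
    ∃ a b : ℕ → ℕ, IsBlockSeq g a b ∧ ∀ i, ∃ k, v i (a k) ≤ b k := by
  obtain ⟨ψ, hψ, hgψ, hψlt⟩ := exists_strictMono_ge g
  choose w hw hvw _ using fun i => exists_strictMono_ge (v i)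
  -- `E i` bounds `a` if the gaps are short for `i` at every `k`; since `a` is built to exceed an
  -- `h` that no shifted `E i` dominates, this cannot happen.
  let E : I → ℕ → ℕ := fun i k => (fun m => ψ (w i m))^[k] (ψ 0)
  have hE : ∀ i k, E i (k + 1) = ψ (w i (E i k)) := fun i k => Function.iterate_succ_apply' _ _ _
  obtain ⟨h, hh⟩ := hI fun i k => E i (k + 1)
  let a : ℕ → ℕ := fun k => Nat.rec (ψ 0) (fun k c => max (h k) (ψ c)) k
  have ha : ∀ k, a (k + 1) = max (h k) (ψ (a k)) := fun k => rfl
  have hψa : ∀ k, ψ (a k) ≤ a (k + 1) := fun k => (ha k).symm ▸ le_max_right _ _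
  -- The gap extends as far as the rate allows, so a short gap forces `a (k + 1)` to be small.
  let b : ℕ → ℕ := fun k => Nat.findGreatest (fun c => ψ c ≤ a (k + 1)) (a (k + 1))
  have hb : ∀ k, ψ (b k) ≤ a (k + 1) := fun k =>
    Nat.findGreatest_spec (P := fun c => ψ c ≤ a (k + 1)) ((hψlt _).le.trans (hψa k)) (hψa k)
  have hbmax : ∀ k c, ψ c ≤ a (k + 1) → c ≤ b k := fun k c hc =>
    Nat.le_findGreatest ((hψlt _).le.trans hc) hc
  refine ⟨a, b, ⟨fun k => hbmax _ _ (hψa k), fun k => (hψlt _).trans_le (hb k),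
    fun k => (hgψ _).trans (hb k), hgψ 0⟩, fun i => ?_⟩
  by_contra! hcon
  have haE : ∀ k, a k ≤ E i k := by
    intro k
    induction k with
    | zero => exact le_rfl
    | succ k ih =>
      rw [hE]
      have h1 : a (k + 1) < ψ (v i (a k)) := by
        by_contra! h1
        exact (hcon k).not_ge (hbmax _ _ h1)
      exact h1.le.trans (hψ.monotone ((hvw i _).trans ((hw i).monotone ih)))
  exact hh i fun k => (le_max_left _ _).trans ((ha k).symm.le.trans (haE (k + 1)))

/-- A dominating family of least size, well-ordered in its initial order type. -/
lemma exists_wellOrdered_dominating :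
    ∃ (ι : Type) (_ : LinearOrder ι) (_ : WellFoundedLT ι) (g : ι → ℕ → ℕ),
      (∀ h : ℕ → ℕ, ∃ i, h ≤ g i) ∧
      ∀ (i : ι) (E : Iio i → ℕ → ℕ), ∃ h : ℕ → ℕ, ∀ j, ¬ h ≤ E j := by
  let D : Set (Set (ℕ → ℕ)) := {F | ∀ h : ℕ → ℕ, ∃ f ∈ F, h ≤ f}
  have hD : ((fun F : Set (ℕ → ℕ) => #F) '' D).Nonempty :=
    ⟨_, univ, fun h => ⟨h, trivial, le_rfl⟩, rfl⟩
  obtain ⟨F, hF, hcard⟩ := csInf_mem hD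
  obtain ⟨e⟩ : Nonempty ((#F).ord.ToType ≃ F) := Cardinal.eq.1 (mk_ord_toType _)
  refine ⟨(#F).ord.ToType, inferInstance, inferInstance, fun i => (e i).1, fun h => ?_,
    fun i E => ?_⟩
  · obtain ⟨f, hf, hle⟩ := hF h
    exact ⟨e.symm ⟨f, hf⟩, by simpa using hle⟩
  · by_contra! hcon
    have h1 : range E ∈ D := fun h => by
      obtain ⟨j, hj⟩ := hcon h
      exact ⟨_, mem_range_self j, hj⟩
    -- A dominating family indexed by `Iio i` would be smaller than the least size.
    have h2 : #F ≤ #(range E) := hcard.le.trans (csInf_le' (mem_image_of_mem _ h1))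
    have h3 : #(Iio i) < #(#F).ord.ToType := mk_Iio_lt i (by simp)
    rw [mk_ord_toType] at h3
    exact (h2.trans mk_range_le).not_gt h3

/-- Well-founded recursion on `i`: the earlier sequences are the family for which the new gaps must
be long. A gap of `i` then contains an interval `[m, a j (3 * m + 1))` with `m = a i k`, so skipping
it leaves the `j`-th gap-bounded set. -/
lemma exists_blockSeq_scale :
    ∃ (ι : Type) (_ : LinearOrder ι) (_ : WellFoundedLT ι) (g a b : ι → ℕ → ℕ),
      (∀ h : ℕ → ℕ, ∃ i, h ≤ g i) ∧ (∀ i, IsBlockSeq (g i) (a i) (b i)) ∧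
      ∀ i, ∀ j < i, ∃ k, a j (3 * a i k + 1) ≤ b i k := by
  obtain ⟨ι, _, _, g, hg, hund⟩ := exists_wellOrdered_dominating
  choose A B hAB hgap using fun i (v : Iio i → ℕ → ℕ) => exists_isBlockSeq (hund i) (g i) v
  let a : ι → ℕ → ℕ := (wellFounded_lt (α := ι)).fix
    fun i rec => A i fun j m => rec j.1 j.2 (3 * m + 1)
  have ha : ∀ i, a i = A i fun j m => a j.1 (3 * m + 1) := fun i =>
    WellFounded.fix_eq _ _ i
  refine ⟨ι, inferInstance, inferInstance, g, a, fun i => B i fun j m => a j.1 (3 * m + 1), hg,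
    fun i => ?_, fun i j hj => ?_⟩
  · rw [ha i]; exact hAB i _
  · rw [ha i]
    exact hgap i (fun j m => a j.1 (3 * m + 1)) ⟨j, hj⟩

/-! ### Closed sets and colourings attached to block sequences -/

/-- `x` takes a value in the interval `[p, q)`. -/
def Meets (x : IncSeq) (p q : ℕ) : Prop := ∃ n, p ≤ x.1 n ∧ x.1 n < q

lemma isClopen_meets (p q : ℕ) : IsClopen {x | Meets x p q} := by
  have : {x | Meets x p q} = ⋃ n ∈ Finset.range q, (fun x : IncSeq => x.1 n) ⁻¹' Ico p q := by
    ext x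
    simp only [Meets, mem_ofPred_eq, Finset.mem_range, mem_iUnion, mem_preimage, mem_Ico,
      exists_prop]
    exact ⟨fun ⟨n, h⟩ => ⟨n, (x.2.le_apply).trans_lt h.2, h⟩, fun ⟨n, _, h⟩ => ⟨n, h⟩⟩
  rw [this]
  exact isClopen_biUnion_finset fun n _ =>
    (isClopen_discrete _).preimage ((continuous_apply n).comp continuous_subtype_val)

/-- The sequences whose range meets `[m, u m)` for all `m`. -/
def gapBounded (u : ℕ → ℕ) : Set IncSeq := {x | ∀ m, Meets x m (u m)}

lemma isClosed_gapBounded (u : ℕ → ℕ) : IsClosed (gapBounded u) := by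
  have : gapBounded u = ⋂ m, {x | Meets x m (u m)} := by ext; simp [gapBounded]
  rw [this]
  exact isClosed_iInter fun m => (isClopen_meets _ _).1

lemma gapBounded_mono {u v : ℕ → ℕ} (h : u ≤ v) : gapBounded u ⊆ gapBounded v :=
  fun _ hx m => (hx m).imp fun _ hn => ⟨hn.1, hn.2.trans_le (h m)⟩

/-- The colour of `x`: which of every third block is met by `x`. -/
def blockColor (a b : ℕ → ℕ) (x : IncSeq) : Set ℕ := {k | Meets x (b (3 * k + 1)) (a (3 * k + 2))}

lemma isClosed_blockColor_eq (a b : ℕ → ℕ) (y : Set ℕ) : IsClosed {x | blockColor a b x = y} := by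
  have : {x | blockColor a b x = y} =
      ⋂ k, {x | Meets x (b (3 * k + 1)) (a (3 * k + 2)) ↔ k ∈ y} := by
    ext x; simp [blockColor, Set.ext_iff]
  rw [this]
  refine isClosed_iInter fun k => ?_
  by_cases hk : k ∈ y
  · simpa [hk] using (isClopen_meets _ _).1
  · simp only [hk, iff_false]
    exact (isClopen_meets _ _).compl.1

lemma exists_subset_gapBounded {C : Set IncSeq} (hC : IsCompact C) :
    ∃ u, C ⊆ gapBounded u := by
  have h : ∀ m, ∃ q, ∀ x ∈ C, Meets x m q := by
    intro m
    obtain ⟨t, ht⟩ := hC.elim_finite_subcover (fun q => {x | Meets x m q})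
      (fun q => (isClopen_meets m q).2)
      fun x _ => mem_iUnion.2 ⟨x.1 m + 1, m, x.2.le_apply, Nat.lt_succ_self _⟩
    refine ⟨t.sup id, fun x hx => ?_⟩
    obtain ⟨q, hq, hxq⟩ := mem_iUnion₂.1 (ht hx)
    obtain ⟨n, h1, h2⟩ := hxq
    exact ⟨n, h1, h2.trans_le (Finset.le_sup (f := id) hq)⟩
  choose u hu using h
  exact ⟨u, fun x hx m => hu m x hx⟩

/-- An uncountable closed set contains an uncountable closed subset that lies in one `K i`, is
almost disjoint from the earlier ones, and on which `f i` is constant or countable-to-one. -/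
lemma exists_closed_subset {ι β : Type} [LinearOrder ι] [WellFoundedLT ι] {u : ι → ℕ → ℕ}
    (hu : ∀ h : ℕ → ℕ, ∃ i, h ≤ u i) {f : ι → IncSeq → β}
    (hf : ∀ i y, IsClosed {x | f i x = y}) {C : Set IncSeq} (hC : IsClosed C)
    (hunc : ¬ C.Countable) :
    ∃ i, ∃ E ⊆ C ∩ gapBounded (u i), IsClosed E ∧ ¬ E.Countable ∧
      (∀ j < i, (E ∩ gapBounded (u j)).Countable) ∧
      ((∃ y, ∀ x ∈ E, f i x = y) ∨ ∀ y, (E ∩ {x | f i x = y}).Countable) := by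
  obtain ⟨φ, hφC, hφ, hinj⟩ := hC.exists_nat_bool_injection_of_not_countable hunc
  obtain ⟨h, hh⟩ := exists_subset_gapBounded (isCompact_range hφ)
  obtain ⟨i₀, hi₀⟩ := hu h
  have hne : {i | ¬ (C ∩ gapBounded (u i)).Countable}.Nonempty :=
    ⟨i₀, fun hc => not_countable_range_of_injective hinj
      (hc.mono (subset_inter hφC (hh.trans (gapBounded_mono hi₀))))⟩
  -- Minimality of `i` makes the intersections with earlier sets countable.
  obtain ⟨i, hi, hmin⟩ := WellFounded.has_min (wellFounded_lt (α := ι)) _ hne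
  have hlt : ∀ j < i, (C ∩ gapBounded (u j)).Countable := fun j hj => by
    by_contra hcon
    exact hmin j hcon hj
  have hcl := hC.inter (isClosed_gapBounded (u i))
  by_cases hy : ∃ y, ¬ (C ∩ gapBounded (u i) ∩ {x | f i x = y}).Countable
  · obtain ⟨y, hy⟩ := hy
    exact ⟨i, _, inter_subset_left, hcl.inter (hf i y), hy,
      fun j hj => (hlt j hj).mono (inter_subset_inter_left _
        (inter_subset_left.trans inter_subset_left)), Or.inl ⟨y, fun x hx => hx.2⟩⟩
  · push Not at hy
    exact ⟨i, _, Subset.rfl, hcl, hi, fun j hj => (hlt j hj).mono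
      (inter_subset_inter_left _ inter_subset_left),
      Or.inr hy⟩


/-! ### Branches of Miller trees along block sequences -/

lemma finite_increasing_lt (m : ℕ) : {σ : List ℕ | σ.Pairwise (· < ·) ∧ ∀ j ∈ σ, j < m}.Finite := by
  refine ((Finset.range m).powerset.finite_toSet.image (fun s => s.sort (· ≤ ·))).subset ?_
  rintro σ ⟨hσ, hm⟩
  refine ⟨σ.toFinset, ?_, ?_⟩
  · exact Finset.mem_coe.2 (Finset.mem_powerset.2 fun j hj =>
      Finset.mem_range.2 (hm j (List.mem_toFinset.1 hj)))
  · exact (List.toFinset_sort _ (hσ.imp fun h => h.ne)).2 (hσ.imp fun h => h.le)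

/-- Infinite splitting allows a jump beyond `m`, and all later entries are larger still. -/
lemma IsMiller.exists_isSplit_extension {M : Descriptive.tree ℕ} (hM : IsMiller M) {σ : List ℕ}
    (hσ : σ ∈ M) (hs : IsSplit M σ) (m : ℕ) :
    ∃ τ ∈ M, IsSplit M τ ∧ σ <+: τ ∧ (∀ j ∈ τ, j ∈ σ ∨ m ≤ j) ∧ ∃ j ∈ τ, j ∉ σ ∧ m ≤ j := by
  obtain ⟨n, hn, hmn⟩ := (hM.superperfect σ hσ hs).exists_gt m
  obtain ⟨τ, hτ, hpre, hsplit⟩ := hM.perfect _ hn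
  obtain ⟨ρ, rfl⟩ := hpre
  have hpw := hM.increasing _ hτ
  rw [List.append_assoc, List.pairwise_append] at hpw
  refine ⟨_, hτ, hsplit, ⟨[n] ++ ρ, by simp⟩, fun j hj => ?_, n, by simp, fun h => ?_, hmn.le⟩
  · simp only [List.append_assoc, List.mem_append, List.mem_singleton] at hj
    rcases hj with hj | rfl | hj
    · exact Or.inl hj
    · exact Or.inr hmn.le
    · have := hpw.2.1
      simp only [List.singleton_append, List.pairwise_cons] at this
      exact Or.inr (hmn.trans (this.1 j hj)).le
  · exact lt_irrefl _ (hpw.2.2 n h n (by simp))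

/-- Past a certain rate, a Miller tree has branches meeting any prescribed infinite set of blocks,
and no gap. -/
lemma IsMiller.exists_rate {M : Descriptive.tree ℕ} (hM : IsMiller M) :
    ∃ ψ : ℕ → ℕ, ∀ g a b : ℕ → ℕ, ψ ≤ g → IsBlockSeq g a b →
      ∀ p : ℕ → Prop, (∀ n, ∃ k ≥ n, p k) →
        ∃ x ∈ branches M, (∀ k, Meets x (b k) (a (k + 1)) ↔ p k) ∧ ∀ k, ¬ Meets x (a k) (b k) := by
  classical
  obtain ⟨σ₀, hσ₀, -, hsplit₀⟩ := hM.perfect _ hM.nonempty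
  choose! τ hτM hτs hpre hmem hnew using
    fun (σ : List ℕ) (m : ℕ) (hσ : σ ∈ M) (hs : IsSplit M σ) => hM.exists_isSplit_extension hσ hs m
  -- Only finitely many increasing `σ` have all entries below `m`, so one bound serves all their
  -- extensions `τ σ m`; this bound is the rate.
  have hbound : ∀ m, ∃ B, (∀ j ∈ σ₀, j < B) ∧
      ∀ σ ∈ M, (∀ j ∈ σ, j < m) → ∀ j ∈ τ σ m, j < B := by
    intro m
    have hfin : ({j | j ∈ σ₀} ∪
        ⋃ σ ∈ {σ : List ℕ | σ.Pairwise (· < ·) ∧ ∀ j ∈ σ, j < m}, {j | j ∈ τ σ m}).Finite :=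
      (List.finite_toSet _).union ((finite_increasing_lt m).biUnion fun σ _ => List.finite_toSet _)
    obtain ⟨B, hB⟩ := hfin.bddAbove
    refine ⟨B + 1, fun j hj => Nat.lt_succ_of_le (hB (Or.inl hj)), fun σ hσ hlt j hj => ?_⟩
    exact Nat.lt_succ_of_le (hB (Or.inr (mem_iUnion₂.2 ⟨σ, ⟨hM.increasing σ hσ, hlt⟩, hj⟩)))
  choose ψ hψ₀ hψ using hbound
  refine ⟨ψ, fun g a b hg hab p hp => ?_⟩
  let s : ℕ → List ℕ := fun k => Nat.rec σ₀ (fun k σ => if p k then τ σ (b k) else σ) k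
  have hs_pos : ∀ k, p k → s (k + 1) = τ (s k) (b k) := fun k hk => if_pos hk
  have hs_neg : ∀ k, ¬ p k → s (k + 1) = s k := fun k hk => if_neg hk
  have hinv : ∀ k, s k ∈ M ∧ IsSplit M (s k) ∧ ∀ j ∈ s k, j < a k := by
    intro k
    induction k with
    | zero =>
      exact ⟨hσ₀, hsplit₀, fun j hj =>
        (hψ₀ 0 j hj).trans_le ((hg 0).trans hab.rate_zero_le)⟩
    | succ k ih =>
      obtain ⟨h1, h2, h3⟩ := ih
      by_cases hk : p k
      · rw [hs_pos k hk]
        exact ⟨hτM _ _ h1 h2, hτs _ _ h1 h2, fun j hj =>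
          (hψ (b k) _ h1 (fun i hi => (h3 i hi).trans_le (hab.le k)) j hj).trans_le
            ((hg _).trans (hab.rate_le k))⟩
      · rw [hs_neg k hk]
        exact ⟨h1, h2, fun j hj => (h3 j hj).trans (hab.strictMono k.lt_succ_self)⟩
  have hchain : ∀ k, s k <+: s (k + 1) := by
    intro k
    by_cases hk : p k
    · rw [hs_pos k hk]; exact hpre _ _ (hinv k).1 (hinv k).2.1
    · rw [hs_neg k hk]
  have hlenmono : Monotone fun k => (s k).length :=
    monotone_nat_of_le_succ fun k => (hchain k).length_le
  have hlen : ∀ n, ∃ k, n ≤ (s k).length := by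
    intro n
    induction n with
    | zero => exact ⟨0, Nat.zero_le _⟩
    | succ n ih =>
      obtain ⟨k, hk⟩ := ih
      obtain ⟨k', hk', hpk⟩ := hp k
      refine ⟨k' + 1, (hk.trans (hlenmono hk')).trans_lt ((hchain k').length_le.lt_of_ne ?_)⟩
      intro heq
      obtain ⟨j, hj, hjs, -⟩ := hnew _ (b k') (hinv k').1 (hinv k').2.1
      rw [← hs_pos k' hpk, ← (hchain k').eq_of_length heq] at hj
      exact hjs hj
  have helem : ∀ K, ∀ j ∈ s K, j < a 0 ∨ ∃ k, p k ∧ b k ≤ j ∧ j < a (k + 1) := by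
    intro K
    induction K with
    | zero => exact fun j hj => Or.inl ((hinv 0).2.2 j hj)
    | succ K ih =>
      intro j hj
      by_cases hK : p K
      · have hlt := (hinv (K + 1)).2.2 j hj
        rw [hs_pos K hK] at hj
        rcases hmem _ _ (hinv K).1 (hinv K).2.1 j hj with h | h
        · exact ih j h
        · exact Or.inr ⟨K, hK, h, hlt⟩
      · rw [hs_neg K hK] at hj
        exact ih j hj
  obtain ⟨x, hx, hseg⟩ := exists_branch_of_chain hM.increasing s (fun k => (hinv k).1) hchain hlen
  have hval : ∀ n, ∃ K, x.1 n ∈ s K := fun n => by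
    obtain ⟨K, hK⟩ := hlen (n + 1)
    refine ⟨K, ?_⟩
    rw [hseg K]
    exact List.mem_map.2 ⟨n, List.mem_range.2 hK, rfl⟩
  have hblock : ∀ n, a 0 ≤ x.1 n → ∃ k, p k ∧ b k ≤ x.1 n ∧ x.1 n < a (k + 1) := fun n hn => by
    obtain ⟨K, hK⟩ := hval n
    exact (helem K _ hK).resolve_left hn.not_gt
  have ha0 : ∀ k, a 0 ≤ a k := fun k => hab.strictMono.monotone (Nat.zero_le k)
  refine ⟨x, hx, fun k => ⟨?_, fun hk => ?_⟩, ?_⟩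
  · rintro ⟨n, h1, h2⟩
    obtain ⟨k', hk', h3, h4⟩ := hblock n ((ha0 k).trans ((hab.le k).trans h1))
    rcases lt_trichotomy k k' with h | rfl | h
    · have := hab.strictMono.monotone (Nat.add_one_le_of_lt h)
      have := hab.le k'
      omega
    · exact hk'
    · have := hab.strictMono.monotone (Nat.add_one_le_of_lt h)
      have := hab.le k
      omega
  · obtain ⟨j, hj, -, hbj⟩ := hnew _ (b k) (hinv k).1 (hinv k).2.1
    rw [← hs_pos k hk] at hj
    have hlt := (hinv (k + 1)).2.2 j hj
    rw [hseg (k + 1)] at hj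
    obtain ⟨n, -, rfl⟩ := List.mem_map.1 hj
    exact ⟨n, hbj, hlt⟩
  · rintro k ⟨n, h1, h2⟩
    obtain ⟨k', hk', h3, h4⟩ := hblock n ((ha0 k).trans h1)
    rcases lt_or_ge k' k with h | h
    · have := hab.strictMono.monotone (Nat.add_one_le_of_lt h)
      omega
    · have := hab.monotone h
      omega

/-- All colours are taken continuum many times on a Miller tree of the right rate, even off the
closed sets with smaller gaps. -/
lemma IsMiller.continuum_le_mk_color {M : Descriptive.tree ℕ} (hM : IsMiller M) :
    ∃ ψ : ℕ → ℕ, ∀ g a b : ℕ → ℕ, ψ ≤ g → IsBlockSeq g a b → ∀ y : Set ℕ,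
      𝔠 ≤ #{x : IncSeq | x ∈ branches M ∧ x ∈ gapBounded (fun m => a (3 * m + 1)) ∧
        blockColor a b x = y ∧ ∀ u : ℕ → ℕ, (∃ k, u (a k) ≤ b k) → x ∉ gapBounded u} := by
  obtain ⟨ψ, hψ⟩ := hM.exists_rate
  refine ⟨ψ, fun g a b hg hab y => ?_⟩
  -- Blocks 0 mod 3 are always met, which bounds the gaps; blocks 1 mod 3 spell the colour `y`;
  -- blocks 2 mod 3 spell a free `z`, which yields continuum many branches.
  let p : Set ℕ → ℕ → Prop := fun z k =>
    k % 3 = 0 ∨ (k % 3 = 1 ∧ k / 3 ∈ y) ∨ (k % 3 = 2 ∧ k / 3 ∈ z)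
  have hp0 : ∀ z k, p z (3 * k) := fun z k => Or.inl (by omega)
  have hp1 : ∀ z k, p z (3 * k + 1) ↔ k ∈ y := fun z k => by
    have h1 : (3 * k + 1) % 3 = 1 := by omega
    have h2 : (3 * k + 1) / 3 = k := by omega
    simp [p, h1, h2]
  have hp2 : ∀ z k, p z (3 * k + 2) ↔ k ∈ z := fun z k => by
    have h1 : (3 * k + 2) % 3 = 2 := by omega
    have h2 : (3 * k + 2) / 3 = k := by omega
    simp [p, h1, h2]
  choose x hxM hxp hxgap using fun z => hψ g a b hg hab (p z) fun n => ⟨3 * n, by omega, hp0 z n⟩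
  have hmem : ∀ z, x z ∈ {x : IncSeq | x ∈ branches M ∧
      x ∈ gapBounded (fun m => a (3 * m + 1)) ∧ blockColor a b x = y ∧
      ∀ u : ℕ → ℕ, (∃ k, u (a k) ≤ b k) → x ∉ gapBounded u} := by
    refine fun z => ⟨hxM z, fun m => ?_, ?_, ?_⟩
    · obtain ⟨n, h1, h2⟩ := (hxp z (3 * m)).2 (hp0 z m)
      have h3 : 3 * m ≤ a (3 * m) := hab.strictMono.le_apply
      have h4 := hab.le (3 * m)
      exact ⟨n, by omega, h2⟩
    · ext k
      exact (hxp z (3 * k + 1)).trans (hp1 z k)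
    · rintro u ⟨k, hk⟩ hu
      obtain ⟨n, h1, h2⟩ := hu (a k)
      exact hxgap z k ⟨n, h1, h2.trans_le hk⟩
  have hinj : Function.Injective fun z => (⟨x z, hmem z⟩ : {x : IncSeq | x ∈ branches M ∧
      x ∈ gapBounded (fun m => a (3 * m + 1)) ∧ blockColor a b x = y ∧
      ∀ u : ℕ → ℕ, (∃ k, u (a k) ≤ b k) → x ∉ gapBounded u}) := by
    intro z z' h
    have hzz : x z = x z' := Subtype.ext_iff.1 h
    ext k
    rw [← hp2 z k, ← hxp, hzz, hxp, hp2]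
  have h := mk_le_of_injective hinj
  rwa [show #(Set ℕ) = 𝔠 by simp] at h


/-! ### A set in `s⁰` that is not in `m⁰` -/

/-- The full tree `ω^{↑<ω}`. -/
def fullTree : Descriptive.tree ℕ :=
  ⟨{σ | σ.Pairwise (· < ·)}, fun _ _ h => (List.pairwise_append.1 h).1⟩

lemma mem_fullTree {σ : List ℕ} : σ ∈ fullTree ↔ σ.Pairwise (· < ·) := Iff.rfl

lemma exists_append_mem_fullTree {σ : List ℕ} (hσ : σ ∈ fullTree) :
    ∃ B, ∀ n ≥ B, σ ++ [n] ∈ fullTree := by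
  obtain ⟨B, hB⟩ := σ.finite_toSet.bddAbove
  refine ⟨B + 1, fun n hn => mem_fullTree.2 (List.pairwise_append.2 ⟨hσ, by simp, ?_⟩)⟩
  intro a ha b hb
  rw [List.mem_singleton] at hb
  have : a ≤ B := hB ha
  omega

lemma isMiller_fullTree : IsMiller fullTree where
  increasing _ h := h
  nonempty := List.Pairwise.nil
  perfect σ hσ := by
    obtain ⟨B, hB⟩ := exists_append_mem_fullTree hσ
    exact ⟨σ, hσ, List.prefix_rfl, B, B + 1, by omega, hB _ le_rfl, hB _ (by omega)⟩
  superperfect σ hσ _ := by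
    obtain ⟨B, hB⟩ := exists_append_mem_fullTree hσ
    exact (Ici_infinite B).mono hB

lemma exists_surjective_of_tree {P : Descriptive.tree ℕ → Prop} (hP : ∃ T, P T) :
    ∃ e : continuum.{0}.ord.ToType → {T // P T}, Function.Surjective e := by
  have hle : #{T // P T} ≤ #continuum.{0}.ord.ToType := by
    rw [mk_ord_toType]
    calc #{T // P T} ≤ #(Set (List ℕ)) :=
          mk_le_of_injective (Subtype.val_injective.comp Subtype.val_injective)
      _ = 𝔠 := by simp
  obtain ⟨f⟩ := hle
  have : Nonempty {T // P T} := let ⟨T, hT⟩ := hP; ⟨⟨T, hT⟩⟩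
  exact ⟨Function.invFun f, Function.invFun_surjective f.injective⟩

/-- The countable pieces have union of size at most `#J * ℵ₀ < 𝔠`, so regularity of 𝔠 plays no role.
-/
lemma exists_notMem_iUnion {β : Type} {F : Set β} (hF : 𝔠 ≤ #F) {J : Type} (hJ : #J < 𝔠)
    {s : J → Set β} (hs : ∀ j, (F ∩ s j).Countable) : ∃ x ∈ F, ∀ j, x ∉ s j := by
  by_contra! hcon
  have hsub : F ⊆ ⋃ j, F ∩ s j := fun x hx => by
    obtain ⟨j, hj⟩ := hcon x hx
    exact mem_iUnion.2 ⟨j, hx, hj⟩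
  have h1 : #F ≤ #J * ℵ₀ := (mk_le_mk_of_subset hsub).trans
    ((mk_iUnion_le _).trans (mul_le_mul_right (ciSup_le' fun j => (hs j).le_aleph0) _))
  exact (hF.trans h1).not_gt (mul_lt_of_lt aleph0_le_continuum hJ aleph0_lt_continuum)

end TreeIdeals

open TreeIdeals

theorem theorem2p2 : (TreeIdeals.sacksIdeal \ TreeIdeals.millerIdeal).Nonempty := by
  obtain ⟨ι, _, _, g, a, b, hg, hab, hgap⟩ := exists_blockSeq_scale
  let u : ι → ℕ → ℕ := fun i m => a i (3 * m + 1)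
  have hu : ∀ h : ℕ → ℕ, ∃ i, h ≤ u i := by
    intro h
    -- A monotone majorant is needed because the rate controls `u i m` only through the value of `g
    -- i` at `b i (3 * m) ≥ m`.
    obtain ⟨h', hmono, hle, -⟩ := exists_strictMono_ge h
    obtain ⟨i, hi⟩ := hg h'
    refine ⟨i, fun m => ?_⟩
    have h1 : 3 * m ≤ a i (3 * m) := (hab i).strictMono.le_apply
    have h2 := (hab i).le (3 * m)
    calc h m ≤ h' m := hle m
      _ ≤ h' (b i (3 * m)) := hmono.monotone (by omega)
      _ ≤ g i (b i (3 * m)) := hi _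
      _ ≤ a i (3 * m + 1) := (hab i).rate_le _
  obtain ⟨M, hM⟩ := exists_surjective_of_tree ⟨_, isMiller_fullTree⟩
  obtain ⟨T, hT⟩ := exists_surjective_of_tree ⟨_, isMiller_fullTree.toIsSacks⟩
  choose η E hsub hcl hunc hlt hcol using fun β =>
    exists_closed_subset hu (f := fun i => blockColor (a i) (b i))
      (fun i y => isClosed_blockColor_eq _ _ y) (isClosed_branches (T β).1)
      (T β).2.not_countable_branches
  have hcard : ∀ α : continuum.{0}.ord.ToType, #(Iio α) < 𝔠 := fun α => by
    have h : #(Iio α) < #continuum.{0}.ord.ToType := mk_Iio_lt α (by simp)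
    rwa [mk_ord_toType] at h
  have hpoint : ∀ α, ∃ x ∈ branches (M α).1, ∀ β < α, x ∉ E β := by
    intro α
    obtain ⟨ψ, hψ⟩ := (M α).2.continuum_le_mk_color
    obtain ⟨ξ, hξ⟩ := hg ψ
    -- Each `β < α` rules out at most one colour; nonemptiness of `E β` makes that colour unique.
    obtain ⟨y, -, hy⟩ : ∃ y ∈ (univ : Set (Set ℕ)), ∀ β : Iio α,
        y ∉ {y | η β = ξ ∧ (E β).Nonempty ∧ ∀ x ∈ E β, blockColor (a ξ) (b ξ) x = y} := by
      refine exists_notMem_iUnion (by simp) (hcard α) fun β => Set.Subsingleton.countable ?_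
      rintro y ⟨-, -, ⟨x, hx⟩, h⟩ y' ⟨-, -, -, h'⟩
      exact (h x hx).symm.trans (h' x hx)
    obtain ⟨x, hx, hxE⟩ := exists_notMem_iUnion (hψ _ _ _ hξ (hab ξ) y) (hcard α)
      (s := fun β => E β) fun β => by
        rcases lt_trichotomy (η β) ξ with h | h | h
        -- These branches skip the gaps of `ξ`, one of which is too long for the earlier index `η
        -- β`.
        · convert countable_empty
          refine eq_empty_of_forall_notMem fun x hx => ?_
          exact hx.1.2.2.2 _ (hgap ξ _ h) (hsub β hx.2).2
        · rcases hcol β with ⟨y', hy'⟩ | hc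
          · convert countable_empty
            refine eq_empty_of_forall_notMem fun x hx => hy β ⟨h, ⟨x, hx.2⟩, fun x' hx' => ?_⟩
            rw [h] at hy'
            rw [hy' x' hx', ← hy' x hx.2]
            exact hx.1.2.2.1
          · refine (hc y).mono ?_
            rw [h]
            intro x hx
            refine ⟨hx.2, ?_⟩
            exact hx.1.2.2.1
        -- Here `ξ` is the earlier index, and the branches lie in `gapBounded (u ξ)`.
        · refine (hlt β ξ h).mono ?_
          exact fun x hx => ⟨hx.2, hx.1.2.1⟩
    exact ⟨x, hx.1, fun β hβ => hxE ⟨β, hβ⟩⟩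
  choose x hxM hxE using hpoint
  refine ⟨range x, fun T' hT' => ?_, fun h => ?_⟩
  · obtain ⟨β, hβ⟩ := hT ⟨T', hT'⟩
    have hsub' : E β ⊆ branches T' := fun z hz => by
      have := (hsub β hz).1
      rwa [hβ] at this
    refine exists_isSacks_disjoint (hcl β) (hunc β) hsub' ?_
    -- Points chosen after stage `β` avoid `E β`.
    have hle : E β ∩ range x ⊆ insert (x β) (x '' Iio β) := by
      rintro _ ⟨hz, α, rfl⟩
      rcases lt_trichotomy α β with h | rfl | h
      · exact Or.inr ⟨α, h, rfl⟩
      · exact Or.inl rfl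
      · exact (hxE α β h hz).elim
    calc #↥(E β ∩ range x) ≤ #↥(insert (x β) (x '' Iio β)) := mk_le_mk_of_subset hle
      _ ≤ #↥(x '' Iio β) + 1 := mk_insert_le
      _ ≤ #(Iio β) + 1 := by gcongr; exact mk_image_le
      _ < 𝔠 := add_lt_of_lt aleph0_le_continuum (hcard β)
          (one_lt_aleph0.trans_le aleph0_le_continuum)
  · obtain ⟨S, hS, -, hdisj⟩ := h fullTree isMiller_fullTree
    obtain ⟨α, hα⟩ := hM ⟨S, hS⟩
    have hxS := hxM α
    rw [hα] at hxS
    exact disjoint_left.1 hdisj hxS (mem_range_self α)
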